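/- Let $D\ge 1$, let $H_0,H_1,\dots,H_M$ be Hermitian $D\times D$ complex matrices, let $f_1,\dots,f_M$ be real functions such that $H(t)=H_0+\sum_{k=1}^M f_k(t)H_k$ is piecewise continuous on $[0,T]$, $T\ge 0$ (continuous on $[0,T]$ away from finitely many points, with one-sided limits everywhere), and let $U$ be the continuous solution of $i\,\dot U(t)=H(t)U(t)$, $U(0)=I$, on $[0,T]$ (the equation holding except at finitely many times). Let $V$ be a unitary matrix commuting with all $H_1,\dots,H_M$ and with $[H_0,V]\ne 0$. Let $\mathcal L$ be any real Lie algebra of anti-Hermitian $D\times D$ matrices that contains $iH_0,\ iH_1,\dots,iH_M$ and $iVH_0V^\dagger$ (for example the Lie algebra generated by these, or $\mathfrak u(D)$). With $\|A\|_F=\sqrt{\operatorname{tr}A^\dagger A}$ put, for $U_1,U_2\in e^{\mathcal L}=\{e^C : C\in\mathcal L\}$, $$d(U_1,U_2)=\min\{\|C\|_F : C\in\mathcal L,\ e^C=U_1U_2^{-1}\}.$$ Then $U(T)\in e^{\mathcal L}$ and $VU(T)V^\dagger\in e^{\mathcal L}$, the minimum defining $d(U(T),VU(T)V^\dagger)$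 is attained, and $$T\;\ge\;\frac{d\big(U(T),VU(T)V^\dagger\big)}{\|[H_0,V]\|_F}\;\ge\;\frac{\|[U(T),V]\|_F}{\|[H_0,V]\|_F}.$$ -/

import Mathlib

open scoped Matrix Topology
open scoped Matrix.Norms.Frobenius

attribute [local instance] LieRing.ofAssociativeRing

/-- The norm on matrices in force is the Frobenius norm `√(tr A†A)`. -/
theorem norm_eq_sqrt_trace {D : ℕ} (A : Matrix (Fin D) (Fin D) ℂ) :
    ‖A‖ = √(Aᴴ * A).trace.re := by
  rw [Matrix.frobenius_norm_def, ← Real.sqrt_eq_rpow, Matrix.trace, Finset.sum_comm, Complex.re_sum]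
  congr 1
  refine Finset.sum_congr rfl fun i _ => ?_
  rw [Matrix.diag_apply, Matrix.mul_apply, Complex.re_sum]
  refine Finset.sum_congr rfl fun j _ => ?_
  rw [Matrix.conjTranspose_apply, Complex.star_def, ← Complex.normSq_eq_conj_mul_self,
    Complex.ofReal_re, Complex.normSq_eq_norm_sq, Real.rpow_two]

/-- `f` is piecewise continuous on `[0, T]`: it is continuous there away from finitely many points,
and has a right limit at every point of `[0, T)` and a left limit at every point of `(0, T]`. -/
def PiecewiseContinuous {E : Type*} [TopologicalSpace E] (f : ℝ → E) (T : ℝ) : Prop :=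
  (∃ S : Finset ℝ, ∀ t ∈ Set.Icc 0 T, t ∉ S → ContinuousWithinAt f (Set.Icc 0 T) t) ∧
  (∀ t ∈ Set.Ico 0 T, ∃ l, Filter.Tendsto f (𝓝[>] t) (𝓝 l)) ∧
  (∀ t ∈ Set.Ioc 0 T, ∃ l, Filter.Tendsto f (𝓝[<] t) (𝓝 l))

/-- `U` solves the Schrödinger equation `i dU/dt = H(t) U(t)`, `U(0) = I`, on `[0, T]`: it is
continuous, and the equation holds except at finitely many times (where `H` may jump). -/
def IsSchrodingerSolution {D : ℕ} (H U : ℝ → Matrix (Fin D) (Fin D) ℂ) (T : ℝ) : Prop :=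
  U 0 = 1 ∧ ContinuousOn U (Set.Icc 0 T) ∧
  ∃ S : Finset ℝ, ∀ t ∈ Set.Ioo 0 T, t ∉ S →
    ∃ U' : Matrix (Fin D) (Fin D) ℂ, HasDerivAt U U' t ∧ Complex.I • U' = H t * U t

/-- The dynamical Lie algebra of a set of Hamiltonians: the real Lie algebra of matrices generated
by the operators `i H`. -/
noncomputable def dynamicalLieAlgebra {D : ℕ} (S : Set (Matrix (Fin D) (Fin D) ℂ)) :
    LieSubalgebra ℝ (Matrix (Fin D) (Fin D) ℂ) :=
  LieSubalgebra.lieSpan ℝ (Matrix (Fin D) (Fin D) ℂ) ((fun H => Complex.I • H) '' S)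

/-- The set `e^ℒ` of exponentials of the elements of `ℒ`. -/
def expImage {D : ℕ} (ℒ : LieSubalgebra ℝ (Matrix (Fin D) (Fin D) ℂ)) :
    Set (Matrix (Fin D) (Fin D) ℂ) :=
  {W | ∃ C ∈ ℒ, NormedSpace.exp C = W}

/-- The Frobenius norms `‖C‖` of the generators `C ∈ ℒ` with `e^C = U₁ U₂⁻¹`. -/
def generatorNorms {D : ℕ} (ℒ : LieSubalgebra ℝ (Matrix (Fin D) (Fin D) ℂ))
    (U₁ U₂ : Matrix (Fin D) (Fin D) ℂ) : Set ℝ :=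
  {r | ∃ C ∈ ℒ, NormedSpace.exp C = U₁ * U₂⁻¹ ∧ ‖C‖ = r}

/-- The distance `d(U₁, U₂) = min {‖C‖ | C ∈ ℒ, e^C = U₁ U₂⁻¹}` with respect to `ℒ`. -/
noncomputable def unitaryDist {D : ℕ} (ℒ : LieSubalgebra ℝ (Matrix (Fin D) (Fin D) ℂ))
    (U₁ U₂ : Matrix (Fin D) (Fin D) ℂ) : ℝ :=
  sInf (generatorNorms ℒ U₁ U₂)

open Filter Set
open scoped ComplexOrder

variable {D : ℕ}

/-! Since `V` commutes with the controls, `U` and `VUV†` have generators differing by a constant `B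
∈ ℒ` with `‖B‖ = ‖[H₀,V]‖`. The common part cancels in `(VUV†)†U`, which therefore moves with
velocity in `ℒ` of norm `‖B‖`. The upper bound on the distance reduces to
`exists_generator_norm_le`: a curve from `1` with velocities in `ℒ` of norm at most `κ` has at time
`t` a generator in `ℒ` of norm at most `κt`.

Geometrically, one-parameter subgroups are the geodesics of the bi-invariant metric. The proof
avoids Riemannian geometry, and any closedness of the group, by following generators to first order.
In `exists_generator_curve` the velocity splits into a part commuting with `W = e^C`, which
lengthens the generator at a controlled rate, and a part that only conjugates `W`. Continuous
induction with a linear error, then compactness, gives the exact bound. -/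

/-! ### Conjugation by exponentials. -/

/-- A closed subspace of a Banach algebra that is stable under the commutator with `Z` is stable
under conjugation by `e^Z`. -/
theorem Submodule.exp_conj_mem {𝔸 : Type*} [NormedRing 𝔸] [NormedAlgebra ℝ 𝔸] [CompleteSpace 𝔸]
    (S : Submodule ℝ 𝔸) (hS : IsClosed (S : Set 𝔸)) {Z X : 𝔸}
    (hZ : ∀ Y ∈ S, Z * Y - Y * Z ∈ S) (hX : X ∈ S) :
    NormedSpace.exp Z * X * NormedSpace.exp (-Z) ∈ S := by
  have hexp : NormedSpace.exp Z * NormedSpace.exp (-Z) = 1 := by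
    have hc : Commute Z (-Z) := (Commute.refl Z).neg_right
    let _ : NormedAlgebra ℚ 𝔸 := NormedAlgebra.restrictScalars ℚ ℝ 𝔸
    rw [← NormedSpace.exp_add_of_commute hc, add_neg_cancel, NormedSpace.exp_zero]
  let ad : 𝔸 →L[ℝ] 𝔸 := ContinuousLinearMap.mul ℝ 𝔸 Z - (ContinuousLinearMap.mul ℝ 𝔸).flip Z
  have had (Y) : ad Y = Z * Y - Y * Z := by simp [ad]
  have hinv (n : ℕ) : (ad ^ n) X ∈ S := by
    induction n with
    | zero => simpa
    | succ n ih =>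
      rw [pow_succ']
      change ad ((ad ^ n) X) ∈ S
      rw [had]
      exact hZ _ ih
  -- `y` solves `y' = [Z, y]`, so `e^(-sZ) y e^(sZ)` is constant. Hence `e^Z X e^(-Z) = e^(ad Z) X`,
  -- a series whose partial sums lie in `S`.
  let y : ℝ → 𝔸 := fun s => NormedSpace.exp (s • ad) X
  have hy (s : ℝ) : HasDerivAt y (Z * y s - y s * Z) s := by
    have h := (hasDerivAt_exp_smul_const' ad s).clm_apply (hasDerivAt_const s X)
    simpa [had, y] using h
  have hconst (s : ℝ) : NormedSpace.exp (s • -Z) * y s * NormedSpace.exp (s • Z) = X := by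
    have hd (s : ℝ) : HasDerivAt
        (fun s : ℝ => NormedSpace.exp (s • -Z) * y s * NormedSpace.exp (s • Z)) 0 s := by
      have h := ((hasDerivAt_exp_smul_const (-Z) s).fun_mul (hy s)).fun_mul
        (hasDerivAt_exp_smul_const' Z s)
      refine h.congr_deriv ?_
      noncomm_ring
    have := is_const_of_deriv_eq_zero (fun s => (hd s).differentiableAt) (fun s => (hd s).deriv) s 0
    have hy0 : y 0 = X := by
      have h0 : (0 : ℝ) • ad = 0 := zero_smul ℝ ad
      change NormedSpace.exp ((0 : ℝ) • ad) X = X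
      rw [h0, NormedSpace.exp_zero]
      rfl
    rw [this, hy0]
    simp [NormedSpace.exp_zero]
  have h1 := hconst 1
  simp only [one_smul] at h1
  have hy1 : NormedSpace.exp Z * X * NormedSpace.exp (-Z) = NormedSpace.exp ad X := by
    have hy1 : y 1 = NormedSpace.exp ad X := by simp [y]
    rw [← hy1, ← h1]
    simp only [← mul_assoc, hexp, one_mul]
    rw [mul_assoc, hexp, mul_one]
  rw [hy1]
  have hs := (NormedSpace.exp_series_hasSum_exp' (𝕂 := ℝ) ad).mapL
    (ContinuousLinearMap.apply ℝ 𝔸 X)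
  refine hS.mem_of_tendsto hs (Eventually.of_forall fun s => ?_)
  exact S.sum_mem fun n _ => S.smul_mem _ (hinv n)

/-! ### Frobenius geometry and matrix exponentials. -/

/-- The real inner product `Re tr(A†B)` on complex matrices, which induces the Frobenius norm. -/
noncomputable abbrev frobeniusInnerProductSpace :
    InnerProductSpace ℝ (Matrix (Fin D) (Fin D) ℂ) where
  toNormedSpace := inferInstance
  inner A B := (Aᴴ * B).trace.re
  norm_sq_eq_re_inner A := by
    have h : 0 ≤ (Aᴴ * A).trace.re := by
      have := (Matrix.posSemidef_conjTranspose_mul_self A).trace_nonneg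
      exact (Complex.le_def.1 this).1
    rw [norm_eq_sqrt_trace, Real.sq_sqrt h]
    rfl
  conj_inner_symm A B := by
    change (Bᴴ * A).trace.re = _
    rw [← Complex.conj_re, ← Complex.star_def, ← Matrix.trace_conjTranspose,
      Matrix.conjTranspose_mul, Matrix.conjTranspose_conjTranspose]
  add_left A B C := by
    simp [Matrix.add_mul]
  smul_left A B r := by
    simp

attribute [local instance] frobeniusInnerProductSpace

theorem frobenius_inner_eq (A B : Matrix (Fin D) (Fin D) ℂ) :
    inner ℝ A B = (Aᴴ * B).trace.re := rfl

theorem frobenius_norm_unitary_mul {W : Matrix (Fin D) (Fin D) ℂ}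
    (hW : Wᴴ * W = 1) (A : Matrix (Fin D) (Fin D) ℂ) : ‖W * A‖ = ‖A‖ := by
  rw [norm_eq_sqrt_trace, norm_eq_sqrt_trace, Matrix.conjTranspose_mul, Matrix.mul_assoc,
    ← Matrix.mul_assoc Wᴴ, hW, Matrix.one_mul]

theorem frobenius_norm_mul_unitary {W : Matrix (Fin D) (Fin D) ℂ}
    (hW : W * Wᴴ = 1) (A : Matrix (Fin D) (Fin D) ℂ) : ‖A * W‖ = ‖A‖ := by
  rw [norm_eq_sqrt_trace, norm_eq_sqrt_trace, Matrix.conjTranspose_mul, Matrix.mul_assoc,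
    Matrix.trace_mul_comm, Matrix.mul_assoc, Matrix.mul_assoc, hW, Matrix.mul_one]

theorem conjTranspose_exp_of_antiHermitian {C : Matrix (Fin D) (Fin D) ℂ} (hC : Cᴴ = -C) :
    (NormedSpace.exp C)ᴴ = NormedSpace.exp (-C) := by
  rw [← Matrix.exp_conjTranspose, hC]

theorem exp_mul_exp_neg_self (C : Matrix (Fin D) (Fin D) ℂ) :
    NormedSpace.exp C * NormedSpace.exp (-C) = 1 := by
  rw [← Matrix.exp_add_of_commute _ _ (Commute.refl C).neg_right, add_neg_cancel,
    NormedSpace.exp_zero]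

theorem exp_neg_mul_exp_self (C : Matrix (Fin D) (Fin D) ℂ) :
    NormedSpace.exp (-C) * NormedSpace.exp C = 1 := by
  simpa using exp_mul_exp_neg_self (-C)

theorem exp_conj_of_mul_eq_one {P Q : Matrix (Fin D) (Fin D) ℂ} (h : P * Q = 1)
    (C : Matrix (Fin D) (Fin D) ℂ) :
    NormedSpace.exp (P * C * Q) = P * NormedSpace.exp C * Q := by
  have hQ : Q = P⁻¹ := (Matrix.inv_eq_right_inv h).symm
  rw [hQ, Matrix.exp_conj _ _ (IsUnit.of_mul_eq_one _ h)]

theorem hasDerivAt_exp_smul (Z : Matrix (Fin D) (Fin D) ℂ) (t : ℝ) :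
    HasDerivAt (fun s : ℝ => NormedSpace.exp (s • Z)) (Z * NormedSpace.exp (t • Z)) t :=
  hasDerivAt_exp_smul_const' Z t

theorem continuous_matrix_exp :
    Continuous (NormedSpace.exp : Matrix (Fin D) (Fin D) ℂ → Matrix (Fin D) (Fin D) ℂ) :=
  NormedSpace.exp_continuous

theorem LieSubalgebra.isClosed_matrix (ℒ : LieSubalgebra ℝ (Matrix (Fin D) (Fin D) ℂ)) :
    IsClosed (ℒ : Set (Matrix (Fin D) (Fin D) ℂ)) :=
  ℒ.toSubmodule.closed_of_finiteDimensional

/-- A Lie subalgebra is stable under conjugation by the exponentials of its elements. -/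
theorem LieSubalgebra.exp_conj_mem (ℒ : LieSubalgebra ℝ (Matrix (Fin D) (Fin D) ℂ))
    {Z X : Matrix (Fin D) (Fin D) ℂ} (hZ : Z ∈ ℒ) (hX : X ∈ ℒ) :
    NormedSpace.exp Z * X * NormedSpace.exp (-Z) ∈ ℒ :=
  ℒ.toSubmodule.exp_conj_mem ℒ.isClosed_matrix (fun _ hY => ℒ.lie_mem hZ hY) hX

/-! ### First-order motion of generators. -/

/-- Every element of `ℒ` is the sum of one that commutes with `W` and is no longer, and one that is
tangent to the conjugates of `W`. -/
theorem exists_commute_add_sub_conj (ℒ : LieSubalgebra ℝ (Matrix (Fin D) (Fin D) ℂ))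
    {W : Matrix (Fin D) (Fin D) ℂ} (hW : W * Wᴴ = 1) (hWℒ : ∀ Z ∈ ℒ, W * Z * Wᴴ ∈ ℒ)
    {A : Matrix (Fin D) (Fin D) ℂ} (hA : A ∈ ℒ) :
    ∃ B ∈ ℒ, ∃ Z ∈ ℒ, Commute B W ∧ ‖B‖ ≤ ‖A‖ ∧ A = B + (Z - W * Z * Wᴴ) := by
  have hW' : Wᴴ * W = 1 := mul_eq_one_comm.1 hW
  -- `R` is the image of `ℒ` under `1 - Ad W`, and `B` is the component of `A` orthogonal to it.
  let R : Submodule ℝ (Matrix (Fin D) (Fin D) ℂ) := ℒ.toSubmodule.map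
    (LinearMap.id - (LinearMap.mulLeft ℝ W).comp (LinearMap.mulRight ℝ Wᴴ))
  obtain ⟨y, ⟨Z, hZ, rfl⟩, B, hB, hAB⟩ := R.exists_add_mem_mem_orthogonal A
  have hRB {Z'} (hZ' : Z' ∈ ℒ) : inner ℝ (Z' - W * Z' * Wᴴ) B = 0 := by
    refine hB _ ⟨Z', hZ', ?_⟩
    simp [Matrix.mul_assoc]
  have hAB' : A = B + (Z - W * Z * Wᴴ) := by
    rw [hAB, add_comm]
    simp [Matrix.mul_assoc]
  have hBmem : B ∈ ℒ := by
    have : B = A - (Z - W * Z * Wᴴ) := by rw [hAB']; abel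
    rw [this]
    exact ℒ.sub_mem hA (ℒ.sub_mem hZ (hWℒ Z hZ))
  refine ⟨B, hBmem, Z, hZ, ?_, ?_, hAB'⟩
  · have hn : ‖W * B * Wᴴ‖ = ‖B‖ := by
      rw [frobenius_norm_mul_unitary (by simpa using hW'), frobenius_norm_unitary_mul hW']
    -- `B ⊥ B - WBW†` gives `⟨WBW†, B⟩ = ‖B‖²`; as both vectors have norm `‖B‖`, they coincide.
    have h0 := hRB hBmem
    have hd : ‖B - W * B * Wᴴ‖ ^ 2 = 0 := by
      have h1 := norm_sub_sq_real B (W * B * Wᴴ)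
      rw [inner_sub_left, real_inner_self_eq_norm_sq, real_inner_comm] at h0
      rw [h1, hn]
      linarith
    have hd' : B = W * B * Wᴴ := by simpa [sub_eq_zero] using hd
    calc B * W = W * B * Wᴴ * W := by rw [← hd']
      _ = W * B := by rw [Matrix.mul_assoc, hW', Matrix.mul_one]
  · have h0 := hRB hZ
    have h1 : ‖A‖ ^ 2 = ‖B‖ ^ 2 + ‖Z - W * Z * Wᴴ‖ ^ 2 := by
      rw [hAB', norm_add_sq_real, real_inner_comm, h0]
      ring
    exact (sq_le_sq₀ (norm_nonneg _) (norm_nonneg _)).1 (by nlinarith [sq_nonneg ‖Z - W * Z * Wᴴ‖])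

/-- Among the generators of `W = e^C` that are no longer than `C`, one commutes with a given `B`
that commutes with `W`. -/
theorem exists_commute_generator (ℒ : LieSubalgebra ℝ (Matrix (Fin D) (Fin D) ℂ))
    (hℒ : ∀ C ∈ ℒ, Cᴴ = -C) {B C : Matrix (Fin D) (Fin D) ℂ} (hB : B ∈ ℒ) (hC : C ∈ ℒ)
    (hBC : Commute B (NormedSpace.exp C)) :
    ∃ C' ∈ ℒ, NormedSpace.exp C' = NormedSpace.exp C ∧ ‖C'‖ ≤ ‖C‖ ∧ Commute B C' := by
  let K : Set (Matrix (Fin D) (Fin D) ℂ) :=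
    {C' | C' ∈ ℒ ∧ NormedSpace.exp C' = NormedSpace.exp C ∧ ‖C'‖ ≤ ‖C‖}
  have hK : IsCompact K := by
    refine Metric.isCompact_of_isClosed_isBounded ?_
      ((Metric.isBounded_closedBall (x := 0) (r := ‖C‖)).subset fun C' h => by simpa using h.2.2)
    exact ℒ.isClosed_matrix.inter ((isClosed_eq continuous_matrix_exp continuous_const).inter
      (isClosed_le continuous_norm continuous_const))
  obtain ⟨C', hC', hmax⟩ := hK.exists_isMaxOn ⟨C, hC, rfl, le_rfl⟩
    (f := fun X => inner ℝ B X) (by fun_prop)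
  refine ⟨C', hC'.1, hC'.2.1, hC'.2.2, ?_⟩
  -- `Y` commutes with `e^C`, so conjugating `C'` by `e^(sY)` stays in `K`. Along this curve `⟨B,
  -- ·⟩` has derivative `⟨B, [Y, C']⟩ = -‖Y‖²` at `0`, and maximality of `C'` forces `Y = 0`.
  let Y := B * C' - C' * B
  have hY : Y ∈ ℒ := ℒ.lie_mem hB hC'.1
  have hC'W : Commute C' (NormedSpace.exp C) := by
    rw [← hC'.2.1]
    exact (Commute.refl C').exp_right
  have hYW : Commute Y (NormedSpace.exp C) :=
    (hBC.mul_left hC'W).sub_left (hC'W.mul_left hBC)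
  have hconj (s : ℝ) : NormedSpace.exp (s • Y) * C' * NormedSpace.exp (-(s • Y)) ∈ K := by
    have hsY : s • Y ∈ ℒ := ℒ.smul_mem s hY
    refine ⟨ℒ.exp_conj_mem hsY hC'.1, ?_, ?_⟩
    · rw [exp_conj_of_mul_eq_one (exp_mul_exp_neg_self _), hC'.2.1,
        ((hYW.smul_left s).exp_left).eq, Matrix.mul_assoc, exp_mul_exp_neg_self, Matrix.mul_one]
    · rw [← conjTranspose_exp_of_antiHermitian (hℒ _ hsY), frobenius_norm_mul_unitary,
        frobenius_norm_unitary_mul]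
      · exact hC'.2.2
      · rw [conjTranspose_exp_of_antiHermitian (hℒ _ hsY), exp_neg_mul_exp_self]
      · rw [Matrix.conjTranspose_conjTranspose, conjTranspose_exp_of_antiHermitian (hℒ _ hsY),
          exp_neg_mul_exp_self]
  let g : ℝ → ℝ := fun s =>
    inner ℝ B (NormedSpace.exp (s • Y) * C' * NormedSpace.exp (s • -Y))
  have hg : HasDerivAt g (inner ℝ B (Y * C' - C' * Y)) 0 := by
    have h := ((hasDerivAt_exp_smul Y 0).mul_const C').mul (hasDerivAt_exp_smul (-Y) 0)
    have h' := (hasDerivAt_const (0 : ℝ) B).inner ℝ h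
    refine h'.congr_deriv ?_
    simp [sub_eq_add_neg]
  have hloc : IsLocalMax g 0 := by
    refine Eventually.of_forall fun s => ?_
    have := hmax (hconj s)
    simpa [g] using this
  have hzero := hloc.hasDerivAt_eq_zero hg
  have hYn : inner ℝ B (Y * C' - C' * Y) = -inner ℝ Y Y := by
    rw [frobenius_inner_eq, frobenius_inner_eq, hℒ _ hB, hℒ _ hY,
      ← Complex.neg_re]
    congr 1
    have e1 : (B * (C' * Y)).trace = (B * C' * Y).trace := by rw [Matrix.mul_assoc]
    have e2 : (B * (Y * C')).trace = (C' * B * Y).trace := by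
      rw [← Matrix.mul_assoc, Matrix.trace_mul_comm, Matrix.mul_assoc]
    simp only [Matrix.mul_sub, Matrix.neg_mul, Matrix.trace_sub, Matrix.trace_neg, e1, e2]
    conv_rhs => simp only [Y, Matrix.sub_mul, Matrix.trace_sub]
    simp only [Y]
    ring
  rw [hYn, neg_eq_zero, inner_self_eq_zero] at hzero
  exact sub_eq_zero.1 hzero

/-- The generator of an element of `e^ℒ` can be chosen so that left multiplication by `e^(sA)` is
followed, to first order in `s`, by generators whose norm grows at rate at most `‖A‖`. -/
theorem exists_generator_curve (ℒ : LieSubalgebra ℝ (Matrix (Fin D) (Fin D) ℂ))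
    (hℒ : ∀ C ∈ ℒ, Cᴴ = -C) {A C : Matrix (Fin D) (Fin D) ℂ} (hA : A ∈ ℒ) (hC : C ∈ ℒ) :
    ∃ c : ℝ → Matrix (Fin D) (Fin D) ℂ, (∀ s, c s ∈ ℒ) ∧
      (∀ s, 0 ≤ s → ‖c s‖ ≤ ‖C‖ + s * ‖A‖) ∧ NormedSpace.exp (c 0) = NormedSpace.exp C ∧
      HasDerivAt (fun s => NormedSpace.exp (c s)) (A * NormedSpace.exp C) 0 := by
  have hCstar := conjTranspose_exp_of_antiHermitian (hℒ C hC)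
  obtain ⟨B, hB, Z, hZ, hBW, hBA, hAB⟩ := exists_commute_add_sub_conj ℒ
    (W := NormedSpace.exp C) (by rw [hCstar, exp_mul_exp_neg_self])
    (fun Z hZ => by rw [hCstar]; exact ℒ.exp_conj_mem hC hZ) hA
  obtain ⟨C', hC', hCC', hnorm, hBC'⟩ := exists_commute_generator ℒ hℒ hB hC hBW
  have hexp (s : ℝ) : NormedSpace.exp
      (NormedSpace.exp (s • Z) * (C' + s • B) * NormedSpace.exp (-(s • Z))) =
      NormedSpace.exp (s • Z) * (NormedSpace.exp (s • B) * NormedSpace.exp C) *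
        NormedSpace.exp (s • -Z) := by
    rw [exp_conj_of_mul_eq_one (exp_mul_exp_neg_self _), add_comm C',
      Matrix.exp_add_of_commute _ _ (hBC'.smul_left s), hCC', smul_neg]
  -- Conjugation by `e^(sZ)` preserves the norm; with `W = e^C` the exponential has derivative `(B +
  -- Z)W - WZ = AW` at `0`.
  refine ⟨fun s => NormedSpace.exp (s • Z) * (C' + s • B) * NormedSpace.exp (-(s • Z)),
    fun s => ℒ.exp_conj_mem (ℒ.smul_mem s hZ) (ℒ.add_mem hC' (ℒ.smul_mem s hB)), ?_, ?_, ?_⟩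
  · intro s hs
    have hsZ := conjTranspose_exp_of_antiHermitian (hℒ _ (ℒ.smul_mem s hZ))
    change ‖NormedSpace.exp (s • Z) * (C' + s • B) * NormedSpace.exp (-(s • Z))‖ ≤ _
    rw [← hsZ, frobenius_norm_mul_unitary, frobenius_norm_unitary_mul]
    · calc ‖C' + s • B‖ ≤ ‖C'‖ + ‖s • B‖ := norm_add_le _ _
        _ = ‖C'‖ + s * ‖B‖ := by rw [norm_smul, Real.norm_of_nonneg hs]
        _ ≤ ‖C‖ + s * ‖A‖ := by gcongr
    · rw [hsZ, exp_neg_mul_exp_self]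
    · rw [Matrix.conjTranspose_conjTranspose, hsZ, exp_neg_mul_exp_self]
  · rw [hexp]
    simp [NormedSpace.exp_zero]
  · simp only [hexp]
    have h := ((hasDerivAt_exp_smul Z 0).fun_mul
      ((hasDerivAt_exp_smul B 0).mul_const (NormedSpace.exp C))).fun_mul
        (hasDerivAt_exp_smul (-Z) 0)
    refine h.congr_deriv ?_
    have hcancel : NormedSpace.exp C * Z * NormedSpace.exp (-C) * NormedSpace.exp C =
        NormedSpace.exp C * Z := by
      rw [Matrix.mul_assoc _ _ (NormedSpace.exp C), exp_neg_mul_exp_self, Matrix.mul_one]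
    have hAC : A * NormedSpace.exp C =
        B * NormedSpace.exp C + (Z * NormedSpace.exp C - NormedSpace.exp C * Z) := by
      rw [hAB, hCstar, Matrix.add_mul, Matrix.sub_mul, hcancel]
    rw [hAC]
    simp only [zero_smul, NormedSpace.exp_zero, Matrix.mul_one, Matrix.one_mul, Matrix.mul_neg]
    abel

/-! ### Generators along a curve. -/

/-- A curve that starts at `1` and moves with right velocities `A X`, `A ∈ ℒ`, `‖A‖ ≤ κ`, stays in
`e^ℒ`, and at time `t` has a generator of norm at most `κ t`. -/
theorem exists_generator_norm_le (ℒ : LieSubalgebra ℝ (Matrix (Fin D) (Fin D) ℂ))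
    (hℒ : ∀ C ∈ ℒ, Cᴴ = -C) {T κ : ℝ} (hκ : 0 ≤ κ) {X : ℝ → Matrix (Fin D) (Fin D) ℂ}
    (hX0 : X 0 = 1) (hXc : ContinuousOn X (Icc 0 T))
    (hX : ∀ t ∈ Ico 0 T, ∃ A ∈ ℒ, ‖A‖ ≤ κ ∧ HasDerivWithinAt X (A * X t) (Ici t) t)
    {t : ℝ} (ht : t ∈ Icc 0 T) : ∃ C ∈ ℒ, NormedSpace.exp C = X t ∧ ‖C‖ ≤ κ * t := by
  have hT : 0 ≤ T := ht.1.trans ht.2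
  -- The generator curve matches `X` only to first order, so the induction carries an error `εt`.
  have happrox (ε : ℝ) (hε : 0 < ε) :
      Icc 0 T ⊆ {t | ∃ C ∈ ℒ, ‖C‖ ≤ κ * t ∧ ‖NormedSpace.exp C - X t‖ ≤ ε * t} := by
    refine IsClosed.Icc_subset_of_forall_exists_gt ?_ ⟨0, ℒ.zero_mem, by simp,
      by simp [hX0, NormedSpace.exp_zero]⟩ ?_
    · let X' : ℝ → Matrix (Fin D) (Fin D) ℂ := fun t => X (projIcc 0 T hT t)
      have hX' : Continuous X' :=
        hXc.comp_continuous (continuous_subtype_val.comp continuous_projIcc) fun t =>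
          (projIcc 0 T hT t).2
      have hXX' {t} (ht : t ∈ Icc 0 T) : X' t = X t := by simp [X', projIcc_of_mem hT ht]
      -- The set of good times is the projection of this compact set of pairs (time, generator),
      -- hence closed.
      let K : Set (ℝ × Matrix (Fin D) (Fin D) ℂ) := {p | p.1 ∈ Icc 0 T ∧ p.2 ∈ ℒ ∧
        ‖p.2‖ ≤ κ * p.1 ∧ ‖NormedSpace.exp p.2 - X' p.1‖ ≤ ε * p.1}
      have hexp : Continuous fun p : ℝ × Matrix (Fin D) (Fin D) ℂ => NormedSpace.exp p.2 :=
        continuous_matrix_exp.comp continuous_snd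
      have hKclosed : IsClosed K := by
        refine (isClosed_Icc.preimage continuous_fst).inter
          ((ℒ.isClosed_matrix.preimage continuous_snd).inter
          (IsClosed.inter ?_ ?_))
        · exact isClosed_le continuous_snd.norm (continuous_const.mul continuous_fst)
        · exact isClosed_le (hexp.sub (hX'.comp continuous_fst)).norm
            (continuous_const.mul continuous_fst)
      have hK : IsCompact K := by
        refine ((isCompact_Icc (a := 0) (b := T)).prod (isCompact_closedBall 0 (κ * T))).of_isClosed_subset hKclosed ?_
        rintro p ⟨hp, -, hpn, -⟩
        refine ⟨hp, ?_⟩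
        rw [mem_closedBall_zero_iff]
        exact hpn.trans (by gcongr; exact hp.2)
      convert (hK.image continuous_fst).isClosed using 1
      ext t
      constructor
      · rintro ⟨⟨C, hC, hn, he⟩, ht⟩
        exact ⟨(t, C), ⟨ht, hC, hn, by rwa [hXX' ht]⟩, rfl⟩
      · rintro ⟨⟨t, C⟩, ⟨ht, hC, hn, he⟩, rfl⟩
        exact ⟨⟨C, hC, hn, by rwa [hXX' ht] at he⟩, ht⟩
    · rintro t ⟨⟨C, hC, hCn, hCe⟩, ht⟩ y (hy : t < y)
      obtain ⟨A, hA, hAκ, hder⟩ := hX t ht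
      obtain ⟨c, hc, hcn, hc0, hcd⟩ := exists_generator_curve ℒ hℒ hA hC
      have hshift : HasDerivWithinAt (fun s => X (t + s)) (A * X t) (Ici 0) 0 := by
        have h1 : HasDerivWithinAt (fun s : ℝ => t + s) 1 (Ici 0) 0 :=
          ((hasDerivAt_id (0 : ℝ)).const_add t).hasDerivWithinAt
        have h2 : HasDerivWithinAt X (A * X t) (Ici t) (t + 0) := by rwa [add_zero]
        simpa using! h2.scomp (0 : ℝ) h1 fun s (hs : 0 ≤ s) => by simpa using hs
      -- The error satisfies the same linear equation to first order, so up to `o(s)` it is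
      -- transported by the unitary `e^(sA)` and does not grow.
      have hg : HasDerivWithinAt (fun s => NormedSpace.exp (c s) - X (t + s) -
          NormedSpace.exp (s • A) * (NormedSpace.exp C - X t)) 0 (Ici 0) 0 := by
        have h := (hcd.hasDerivWithinAt.sub hshift).sub
          ((hasDerivAt_exp_smul A 0).mul_const (NormedSpace.exp C - X t)).hasDerivWithinAt
        refine h.congr_deriv ?_
        simp [NormedSpace.exp_zero, Matrix.mul_sub]
      have hsmall := hg.isLittleO.def hε
      have hev : ∀ᶠ s in 𝓝[>] (0 : ℝ), s ∈ Ioc 0 (y - t) :=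
        Ioc_mem_nhdsGT (sub_pos.2 hy)
      obtain ⟨s, hs, hs0, hsy⟩ :=
        ((hsmall.filter_mono (nhdsWithin_mono _ Ioi_subset_Ici_self)).and hev).exists
      refine ⟨t + s, ⟨c s, hc s, ?_, ?_⟩, by linarith, by linarith⟩
      · calc ‖c s‖ ≤ ‖C‖ + s * ‖A‖ := hcn s hs0.le
          _ ≤ κ * t + s * κ := by gcongr
          _ = κ * (t + s) := by ring
      · have hsA := conjTranspose_exp_of_antiHermitian (hℒ _ (ℒ.smul_mem s hA))
        have hnorm : ‖NormedSpace.exp (s • A) * (NormedSpace.exp C - X t)‖ =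
            ‖NormedSpace.exp C - X t‖ :=
          frobenius_norm_unitary_mul (by rw [hsA, exp_neg_mul_exp_self]) _
        have hs' : ‖NormedSpace.exp (c s) - X (t + s) -
            NormedSpace.exp (s • A) * (NormedSpace.exp C - X t)‖ ≤ ε * s := by
          simpa [hc0, NormedSpace.exp_zero, abs_of_pos hs0] using hs
        calc _ ≤ _ + ‖NormedSpace.exp (s • A) * (NormedSpace.exp C - X t)‖ :=
              norm_le_norm_sub_add _ _
          _ ≤ ε * s + ε * t := by rw [hnorm]; exact add_le_add hs' hCe
          _ = ε * (t + s) := by ring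
  have hK : IsCompact ((ℒ : Set (Matrix (Fin D) (Fin D) ℂ)) ∩ Metric.closedBall 0 (κ * t)) :=
    (isCompact_closedBall _ _).inter_left ℒ.isClosed_matrix
  obtain ⟨C, ⟨hC, hCn⟩, hmin⟩ := hK.exists_isMinOn
    ⟨0, ℒ.zero_mem, Metric.mem_closedBall_self (mul_nonneg hκ ht.1)⟩
    (f := fun C => ‖NormedSpace.exp C - X t‖)
    (continuous_matrix_exp.sub continuous_const).norm.continuousOn
  refine ⟨C, hC, ?_, by simpa using hCn⟩
  rw [← sub_eq_zero, ← norm_le_zero_iff]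
  refine le_of_forall_pos_le_add fun δ hδ => ?_
  -- Dividing by `t + 1` rather than `t` covers `t = 0`.
  obtain ⟨C', hC', hn, he⟩ := happrox (δ / (t + 1)) (div_pos hδ (by linarith [ht.1])) ht
  have h1 : ‖NormedSpace.exp C - X t‖ ≤ ‖NormedSpace.exp C' - X t‖ := hmin ⟨hC', by simpa using hn⟩
  have h2 : δ / (t + 1) * t ≤ δ := by
    rw [div_mul_eq_mul_div, div_le_iff₀ (by linarith [ht.1])]
    nlinarith
  linarith

/-! ### Piecewise continuous Hamiltonians. -/

/-- A piecewise continuous function on `[0, T]` is bounded. -/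
theorem PiecewiseContinuous.exists_norm_le {E : Type*} [SeminormedAddCommGroup E] {f : ℝ → E}
    {T : ℝ} (hf : PiecewiseContinuous f T) : ∃ K, 0 ≤ K ∧ ∀ t ∈ Icc 0 T, ‖f t‖ ≤ K := by
  suffices ∃ K, ∀ t ∈ Icc 0 T, ‖f t‖ ≤ K by
    obtain ⟨K, hK⟩ := this
    exact ⟨max K 0, le_max_right _ _, fun t ht => (hK t ht).trans (le_max_left _ _)⟩
  refine isCompact_Icc.induction_on (p := fun s => ∃ K, ∀ t ∈ s, ‖f t‖ ≤ K) ⟨0, by simp⟩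
    (fun s t hst ⟨K, hK⟩ => ⟨K, fun x hx => hK x (hst hx)⟩)
    (fun s t ⟨K, hK⟩ ⟨L, hL⟩ => ⟨max K L, ?_⟩) ?_
  · rintro x (hx | hx)
    · exact (hK x hx).trans (le_max_left _ _)
    · exact (hL x hx).trans (le_max_right _ _)
  · intro t ht
    have hbound {F : Filter ℝ} {l : E} (h : Tendsto f F (𝓝 l)) : ∀ᶠ x in F, ‖f x‖ ≤ ‖l‖ + 1 :=
      (h.norm.eventually_lt_const (lt_add_one _)).mono fun _ => le_of_lt
    have hR : ∃ K, ∀ᶠ x in 𝓝[>] t, x ∈ Icc 0 T → ‖f x‖ ≤ K := by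
      rcases ht.2.lt_or_eq with h | h
      · obtain ⟨l, hl⟩ := hf.2.1 t ⟨ht.1, h⟩
        exact ⟨_, (hbound hl).mono fun x hx _ => hx⟩
      · refine ⟨0, ?_⟩
        filter_upwards [self_mem_nhdsWithin] with x (hx : t < x) hx'
        linarith [hx'.2]
    have hL : ∃ K, ∀ᶠ x in 𝓝[<] t, x ∈ Icc 0 T → ‖f x‖ ≤ K := by
      rcases ht.1.lt_or_eq with h | h
      · obtain ⟨l, hl⟩ := hf.2.2 t ⟨h, ht.2⟩
        exact ⟨_, (hbound hl).mono fun x hx _ => hx⟩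
      · refine ⟨0, ?_⟩
        filter_upwards [self_mem_nhdsWithin] with x (hx : x < t) hx'
        linarith [hx'.1]
    obtain ⟨K, hK⟩ := hR
    obtain ⟨L, hL⟩ := hL
    refine ⟨{x | x ∈ Icc 0 T → ‖f x‖ ≤ max ‖f t‖ (max K L)} ∩ Icc 0 T, ?_, max ‖f t‖ (max K L),
      fun x hx => hx.1 hx.2⟩
    refine inter_mem (mem_nhdsWithin_of_mem_nhds ?_) self_mem_nhdsWithin
    change ∀ᶠ x in 𝓝 t, x ∈ Icc 0 T → ‖f x‖ ≤ max ‖f t‖ (max K L)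
    rw [← nhdsNE_sup_pure, ← nhdsLT_sup_nhdsGT, eventually_sup, eventually_sup, eventually_pure]
    refine ⟨⟨hL.mono fun x hx hx' => ?_, hK.mono fun x hx hx' => ?_⟩, fun _ => le_max_left _ _⟩
    · exact (hx hx').trans ((le_max_right _ _).trans (le_max_right _ _))
    · exact (hx hx').trans ((le_max_left _ _).trans (le_max_right _ _))

/-- A solution of the Schrödinger equation has right velocity `-i H(t+) U(t)`; here `F` is a closed
set that contains the values of `H` and hence its right limits. -/
theorem IsSchrodingerSolution.exists_hasDerivWithinAt {H U : ℝ → Matrix (Fin D) (Fin D) ℂ} {T : ℝ}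
    (hU : IsSchrodingerSolution H U T) (hH : PiecewiseContinuous H T)
    {F : Set (Matrix (Fin D) (Fin D) ℂ)} (hF : IsClosed F)
    (hHF : ∀ t ∈ Icc 0 T, -(Complex.I • H t) ∈ F) {t : ℝ} (ht : t ∈ Ico 0 T) :
    ∃ K ∈ F, HasDerivWithinAt U (K * U t) (Ici t) t := by
  obtain ⟨-, hc, S, hS⟩ := hU
  obtain ⟨l, hl⟩ := hH.2.1 t ht
  have hK : Tendsto (fun s => -(Complex.I • H s)) (𝓝[>] t) (𝓝 (-(Complex.I • l))) :=
    (hl.const_smul _).neg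
  have hioo : ∀ᶠ s in 𝓝[>] t, s ∈ Ioo t T := Ioo_mem_nhdsGT ht.2
  refine ⟨-(Complex.I • l), hF.mem_of_tendsto hK (hioo.mono fun s hs =>
    hHF s ⟨ht.1.trans hs.1.le, hs.2.le⟩), ?_⟩
  have hSt : ∀ᶠ s in 𝓝[>] t, s ∉ S := by
    -- The time `t` may itself be exceptional; only times just after it matter.
    have h1 : ((S.erase t : Finset ℝ) : Set ℝ)ᶜ ∈ 𝓝 t :=
      (S.erase t).finite_toSet.isClosed.isOpen_compl.mem_nhds (by simp)
    filter_upwards [mem_nhdsWithin_of_mem_nhds h1, self_mem_nhdsWithin] with s hs (hts : t < s) hsS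
    exact hs (Finset.mem_coe.2 (Finset.mem_erase.2 ⟨hts.ne', hsS⟩))
  have hder {s} (hs : s ∈ Ioo t T) (hsS : s ∉ S) : HasDerivAt U (-(Complex.I • H s) * U s) s := by
    obtain ⟨U', hU', he⟩ := hS s ⟨ht.1.trans_lt hs.1, hs.2⟩ hsS
    convert hU' using 1
    rw [Matrix.neg_mul, Matrix.smul_mul, ← he, smul_smul, Complex.I_mul_I, neg_one_smul, neg_neg]
  have hUt : ContinuousWithinAt U (Icc 0 T) t := hc t ⟨ht.1, ht.2.le⟩
  have hsub : Ioo t T ⊆ Icc 0 T := fun s hs => ⟨ht.1.trans hs.1.le, hs.2.le⟩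
  refine hasDerivWithinAt_Ici_of_tendsto_deriv (s := {s | s ∈ Ioo t T ∧ s ∉ S})
    (fun s hs => (hder hs.1 hs.2).differentiableAt.differentiableWithinAt)
    (hUt.mono fun s hs => hsub hs.1) (hioo.and hSt) ?_
  have hUlim : Tendsto U (𝓝[>] t) (𝓝 (U t)) := by
    refine hUt.tendsto.mono_left ?_
    rw [← nhdsWithin_Ioo_eq_nhdsGT ht.2]
    exact nhdsWithin_mono _ hsub
  refine (hK.mul hUlim).congr' ?_
  filter_upwards [hioo, hSt] with s hs hsS using (hder hs hsS).deriv.symm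

theorem HasDerivWithinAt.matrix_conjTranspose {X : ℝ → Matrix (Fin D) (Fin D) ℂ}
    {X' : Matrix (Fin D) (Fin D) ℂ} {s : Set ℝ} {t : ℝ} (h : HasDerivWithinAt X X' s t) :
    HasDerivWithinAt (fun t => (X t)ᴴ) X'ᴴ s t :=
  HasDerivWithinAt.star h

/-! ### The distance and the comparison of two evolutions. -/

/-- `‖e^C - 1‖ ≤ ‖C‖` for anti-Hermitian `C`. -/
theorem norm_exp_sub_one_le_of_antiHermitian {C : Matrix (Fin D) (Fin D) ℂ} (hC : Cᴴ = -C) :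
    ‖NormedSpace.exp C - 1‖ ≤ ‖C‖ := by
  have h := norm_image_sub_le_of_norm_deriv_le_segment_01' (E := Matrix (Fin D) (Fin D) ℂ)
    (f := fun s : ℝ => NormedSpace.exp (s • C)) (C := ‖C‖)
    (fun s _ => (hasDerivAt_exp_smul_const C s).hasDerivWithinAt) (fun s _ => ?_)
  · simpa [NormedSpace.exp_zero] using h
  · have hs : (s • C)ᴴ = -(s • C) := by simp [hC]
    have hexp : (NormedSpace.exp (s • C))ᴴ * NormedSpace.exp (s • C) = 1 := by
      rw [conjTranspose_exp_of_antiHermitian hs, exp_neg_mul_exp_self]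
    exact (frobenius_norm_unitary_mul hexp C).le

/-- Generators of bounded norm form a compact set, so a limit of their norms is again the norm of a
generator. -/
theorem isLeast_generatorNorms_unitaryDist (ℒ : LieSubalgebra ℝ (Matrix (Fin D) (Fin D) ℂ))
    {U₁ U₂ : Matrix (Fin D) (Fin D) ℂ} (h : (generatorNorms ℒ U₁ U₂).Nonempty) :
    IsLeast (generatorNorms ℒ U₁ U₂) (unitaryDist ℒ U₁ U₂) := by
  have hb : BddBelow (generatorNorms ℒ U₁ U₂) := by
    refine ⟨0, ?_⟩
    rintro r ⟨C, -, -, rfl⟩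
    exact norm_nonneg C
  refine ⟨IsClosed.csInf_mem ?_ h hb, fun r hr => csInf_le hb hr⟩
  let K : Set (Matrix (Fin D) (Fin D) ℂ) := {C | C ∈ ℒ ∧ NormedSpace.exp C = U₁ * U₂⁻¹}
  have hK : IsClosed K :=
    ℒ.isClosed_matrix.inter (isClosed_eq continuous_matrix_exp continuous_const)
  have himage : generatorNorms ℒ U₁ U₂ = norm '' K := by
    ext r
    constructor
    · rintro ⟨C, h1, h2, h3⟩
      exact ⟨C, ⟨h1, h2⟩, h3⟩
    · rintro ⟨C, ⟨h1, h2⟩, h3⟩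
      exact ⟨C, h1, h2, h3⟩
  rw [himage]
  refine isClosed_of_closure_subset fun r hr => ?_
  obtain ⟨u, hu, hur⟩ := mem_closure_iff_seq_limit.1 hr
  choose C hCK hCu using hu
  have hbdd : ∃ R, ∀ n, ‖C n‖ ≤ R := by
    obtain ⟨R, hR⟩ := hur.bddAbove_range
    exact ⟨R, fun n => by rw [hCu]; exact hR ⟨n, rfl⟩⟩
  obtain ⟨R, hR⟩ := hbdd
  obtain ⟨C₀, hC₀, φ, hφ, hlim⟩ := ((isCompact_closedBall (0 : Matrix (Fin D) (Fin D) ℂ) R).inter_right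
    hK).tendsto_subseq (x := C) fun n => ⟨by simpa using hR n, hCK n⟩
  refine ⟨C₀, hC₀.2, tendsto_nhds_unique hlim.norm ?_⟩
  simpa [Function.comp_def, hCu] using hur.comp hφ.tendsto_atTop

/-- Two evolutions whose generators differ by the constant `B` have distance at most `‖B‖ t`. -/
theorem exists_generator_mul_conjTranspose (ℒ : LieSubalgebra ℝ (Matrix (Fin D) (Fin D) ℂ))
    (hℒ : ∀ C ∈ ℒ, Cᴴ = -C) {T κ : ℝ} (hκ : 0 ≤ κ) {B : Matrix (Fin D) (Fin D) ℂ} (hB : B ∈ ℒ)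
    {X Y : ℝ → Matrix (Fin D) (Fin D) ℂ} (hX0 : X 0 = 1) (hY0 : Y 0 = 1)
    (hXc : ContinuousOn X (Icc 0 T)) (hYc : ContinuousOn Y (Icc 0 T))
    (hXY : ∀ t ∈ Ico 0 T, ∃ K ∈ ℒ, ‖K‖ ≤ κ ∧ HasDerivWithinAt X ((K + B) * X t) (Ici t) t ∧
      HasDerivWithinAt Y (K * Y t) (Ici t) t) {t : ℝ} (ht : t ∈ Icc 0 T) :
    ∃ C ∈ ℒ, NormedSpace.exp C = X t * (Y t)ᴴ ∧ ‖C‖ ≤ ‖B‖ * t := by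
  have hYexp {t} (ht : t ∈ Icc 0 T) : ∃ C ∈ ℒ, NormedSpace.exp C = Y t := by
    obtain ⟨C, hC, he, -⟩ := exists_generator_norm_le ℒ hℒ hκ hY0 hYc (fun t ht => by
      obtain ⟨K, hK, hKκ, -, hd⟩ := hXY t ht
      exact ⟨K, hK, hKκ, hd⟩) ht
    exact ⟨C, hC, he⟩
  -- In `Y†X`, unlike `XY†`, the terms in `K` cancel, leaving the velocity `Y†BY`. Conjugating by
  -- `Y` afterwards yields `XY†` at equal norm.
  obtain ⟨C, hC, he, hn⟩ := exists_generator_norm_le ℒ hℒ (norm_nonneg B)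
    (X := fun t => (Y t)ᴴ * X t) (by simp [hX0, hY0]) (hYc.star.mul hXc) (fun t ht => by
      obtain ⟨K, hK, -, hdX, hdY⟩ := hXY t ht
      obtain ⟨E, hE, hEY⟩ := hYexp (Ico_subset_Icc_self ht)
      have hstar := conjTranspose_exp_of_antiHermitian (hℒ E hE)
      have hYY : Y t * (Y t)ᴴ = 1 := by rw [← hEY, hstar, exp_mul_exp_neg_self]
      have hYY' : (Y t)ᴴ * Y t = 1 := by rw [← hEY, hstar, exp_neg_mul_exp_self]
      refine ⟨(Y t)ᴴ * B * Y t, ?_, ?_, ?_⟩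
      · rw [← hEY, hstar]
        simpa using ℒ.exp_conj_mem (ℒ.neg_mem hE) hB
      · rw [frobenius_norm_mul_unitary hYY,
          frobenius_norm_unitary_mul (by rwa [Matrix.conjTranspose_conjTranspose])]
      · refine (hdY.matrix_conjTranspose.fun_mul hdX).congr_deriv ?_
        have hcancel : (Y t)ᴴ * B * Y t * ((Y t)ᴴ * X t) = (Y t)ᴴ * B * X t := by
          rw [Matrix.mul_assoc, ← Matrix.mul_assoc (Y t), hYY, Matrix.one_mul]
        rw [hcancel, Matrix.conjTranspose_mul, hℒ K hK]
        noncomm_ring) ht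
  obtain ⟨E, hE, hEY⟩ := hYexp ht
  have hstar := conjTranspose_exp_of_antiHermitian (hℒ E hE)
  refine ⟨NormedSpace.exp E * C * NormedSpace.exp (-E), ℒ.exp_conj_mem hE hC, ?_, ?_⟩
  · rw [exp_conj_of_mul_eq_one (exp_mul_exp_neg_self E), he, ← hEY, hstar, ← Matrix.mul_assoc,
      exp_mul_exp_neg_self, Matrix.one_mul]
  · rw [← hstar, frobenius_norm_mul_unitary, frobenius_norm_unitary_mul]
    · exact hn
    · rw [hstar, exp_neg_mul_exp_self]
    · rw [Matrix.conjTranspose_conjTranspose, hstar, exp_neg_mul_exp_self]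

/-! ### The speed limit. -/

theorem mainTheorem7 {D M : ℕ} (T : ℝ) (hT : 0 ≤ T)
    -- drift and control Hamiltonians
    (H₀ : Matrix (Fin D) (Fin D) ℂ) (hH₀ : H₀.IsHermitian)
    (Hc : Fin M → Matrix (Fin D) (Fin D) ℂ) (hHc : ∀ k, (Hc k).IsHermitian)
    -- modulations, with a piecewise continuous total Hamiltonian
    (f : Fin M → ℝ → ℝ) (H : ℝ → Matrix (Fin D) (Fin D) ℂ)
    (hH : ∀ t, H t = H₀ + ∑ k, f k t • Hc k) (hHpc : PiecewiseContinuous H T)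
    (U : ℝ → Matrix (Fin D) (Fin D) ℂ) (hU : IsSchrodingerSolution H U T)
    -- a unitary commuting with all control Hamiltonians, but not with the drift
    (V : Matrix (Fin D) (Fin D) ℂ) (hV : V ∈ Matrix.unitaryGroup (Fin D) ℂ)
    (hVc : ∀ k, Commute V (Hc k)) (hV₀ : ⁅H₀, V⁆ ≠ 0)
    -- the Lie algebra of anti-Hermitian matrices with respect to which `d` is taken
    (ℒ : LieSubalgebra ℝ (Matrix (Fin D) (Fin D) ℂ)) (hℒ : ∀ C ∈ ℒ, Cᴴ = -C)
    (hgen : dynamicalLieAlgebra ({H₀, V * H₀ * Vᴴ} ∪ Set.range Hc) ≤ ℒ) :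
    -- the distance is well defined: both unitaries lie in `e^ℒ` and the minimum is attained
    (U T ∈ expImage ℒ ∧ V * U T * Vᴴ ∈ expImage ℒ ∧
      IsLeast (generatorNorms ℒ (U T) (V * U T * Vᴴ)) (unitaryDist ℒ (U T) (V * U T * Vᴴ))) ∧
    T ≥ unitaryDist ℒ (U T) (V * U T * Vᴴ) / ‖⁅H₀, V⁆‖ ∧
    unitaryDist ℒ (U T) (V * U T * Vᴴ) / ‖⁅H₀, V⁆‖ ≥ ‖⁅U T, V⁆‖ / ‖⁅H₀, V⁆‖ := by

  have hVV : V * Vᴴ = 1 := Matrix.mem_unitaryGroup_iff.1 hV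
  have hVV' : Vᴴ * V = 1 := Matrix.mem_unitaryGroup_iff'.1 hV
  have hmem {A} (hA : A ∈ ({H₀, V * H₀ * Vᴴ} ∪ Set.range Hc : Set (Matrix (Fin D) (Fin D) ℂ))) :
      Complex.I • A ∈ ℒ := hgen (LieSubalgebra.subset_lieSpan ⟨A, hA, rfl⟩)
  have h0 : Complex.I • H₀ ∈ ℒ := hmem (by simp)
  have h1 : Complex.I • (V * H₀ * Vᴴ) ∈ ℒ := hmem (by simp)
  let B : Matrix (Fin D) (Fin D) ℂ := Complex.I • (V * H₀ * Vᴴ) - Complex.I • H₀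
  have hB : B ∈ ℒ := ℒ.sub_mem h1 h0
  have hBnorm : ‖B‖ = ‖⁅H₀, V⁆‖ := by
    have hBV : B * V = -(Complex.I • ⁅H₀, V⁆) := by
      rw [Ring.lie_def, Matrix.sub_mul, Matrix.smul_mul, Matrix.smul_mul, Matrix.mul_assoc _ Vᴴ,
        hVV', Matrix.mul_one, smul_sub]
      abel
    rw [← frobenius_norm_mul_unitary hVV, hBV, norm_neg, norm_smul, Complex.norm_I, one_mul]
  have hconj (t : ℝ) : V * H t * Vᴴ = H t + (V * H₀ * Vᴴ - H₀) := by
    have hc : V * (∑ k, f k t • Hc k) * Vᴴ = ∑ k, f k t • Hc k := by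
      have : Commute V (∑ k, f k t • Hc k) :=
        Commute.sum_right _ _ _ fun k _ => (hVc k).smul_right _
      rw [this.eq, Matrix.mul_assoc, hVV, Matrix.mul_one]
    rw [hH, Matrix.mul_add, Matrix.add_mul, hc]
    abel
  obtain ⟨κ, hκ, hκH⟩ := hHpc.exists_norm_le
  -- Closed conditions on `-iH(t)`, so they pass to right limits. Stability of `ℒ` under conjugation
  -- by `V` is not assumed; it is recorded for these elements only.
  let F : Set (Matrix (Fin D) (Fin D) ℂ) :=
    {K | K ∈ ℒ ∧ ‖K‖ ≤ κ + ‖B‖ ∧ V * K * Vᴴ ∈ ℒ ∧ ‖V * K * Vᴴ‖ ≤ κ + ‖B‖ ∧ K = V * K * Vᴴ + B}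
  have hcV : Continuous fun K : Matrix (Fin D) (Fin D) ℂ => V * K * Vᴴ := by fun_prop
  have hF : IsClosed F :=
    ℒ.isClosed_matrix.inter ((isClosed_le continuous_norm continuous_const).inter
      ((ℒ.isClosed_matrix.preimage hcV).inter
        ((isClosed_le hcV.norm continuous_const).inter
          (isClosed_eq continuous_id (hcV.add continuous_const)))))
  have hHF (t) (ht : t ∈ Icc 0 T) : -(Complex.I • H t) ∈ F := by
    have hHt : -(Complex.I • H t) ∈ ℒ := by
      rw [hH, smul_add, Finset.smul_sum]
      refine ℒ.neg_mem (ℒ.add_mem h0 (ℒ.toSubmodule.sum_mem fun k _ => ?_))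
      rw [smul_comm]
      exact ℒ.smul_mem _ (hmem (by simp))
    have hHn : ‖-(Complex.I • H t)‖ ≤ κ := by
      rw [norm_neg, norm_smul, Complex.norm_I, one_mul]
      exact hκH t ht
    have hVH : V * -(Complex.I • H t) * Vᴴ = -(Complex.I • H t) - B := by
      rw [Matrix.mul_neg, Matrix.mul_smul, Matrix.neg_mul, Matrix.smul_mul, hconj, smul_add,
        smul_sub]
      simp only [B]
      abel
    refine ⟨hHt, by linarith [norm_nonneg B], ?_, ?_, ?_⟩
    · rw [hVH]
      exact ℒ.sub_mem hHt hB
    · rw [hVH]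
      exact (norm_sub_le _ _).trans (by gcongr)
    · rw [hVH, sub_add_cancel]
  have hder (t) (ht : t ∈ Ico 0 T) := hU.exists_hasDerivWithinAt hHpc hF hHF ht
  have hκB : 0 ≤ κ + ‖B‖ := by positivity
  have hTT : T ∈ Icc 0 T := ⟨hT, le_rfl⟩
  have hY0 : V * U 0 * Vᴴ = 1 := by rw [hU.1, Matrix.mul_one, hVV]
  have hYc : ContinuousOn (fun t => V * U t * Vᴴ) (Icc 0 T) := hcV.comp_continuousOn hU.2.1
  have hdY {t : ℝ} {K} (h : HasDerivWithinAt U (K * U t) (Ici t) t) :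
      HasDerivWithinAt (fun t => V * U t * Vᴴ) (V * K * Vᴴ * (V * U t * Vᴴ)) (Ici t) t := by
    refine ((h.const_mul V).mul_const Vᴴ).congr_deriv ?_
    simp only [Matrix.mul_assoc]
    rw [← Matrix.mul_assoc Vᴴ V, hVV', Matrix.one_mul]
  obtain ⟨C₁, hC₁, he₁, -⟩ := exists_generator_norm_le ℒ hℒ hκB hU.1 hU.2.1 (fun t ht => by
    obtain ⟨K, hK, hd⟩ := hder t ht
    exact ⟨K, hK.1, hK.2.1, hd⟩) hTT
  obtain ⟨C₂, hC₂, he₂, -⟩ := exists_generator_norm_le ℒ hℒ hκB hY0 hYc (fun t ht => by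
    obtain ⟨K, hK, hd⟩ := hder t ht
    exact ⟨_, hK.2.2.1, hK.2.2.2.1, hdY hd⟩) hTT
  obtain ⟨C, hC, he, hn⟩ := exists_generator_mul_conjTranspose ℒ hℒ hκB hB hU.1 hY0 hU.2.1 hYc
    (fun t ht => by
      obtain ⟨K, hK, hd⟩ := hder t ht
      refine ⟨_, hK.2.2.1, hK.2.2.2.1, ?_, hdY hd⟩
      rwa [← hK.2.2.2.2]) hTT
  have hYstar : (V * U T * Vᴴ)ᴴ = NormedSpace.exp (-C₂) := by
    rw [← he₂, conjTranspose_exp_of_antiHermitian (hℒ C₂ hC₂)]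
  have hYinv : (V * U T * Vᴴ)⁻¹ = (V * U T * Vᴴ)ᴴ := by
    refine Matrix.inv_eq_right_inv ?_
    rw [hYstar, ← he₂, exp_mul_exp_neg_self]
  have hmemC : ‖C‖ ∈ generatorNorms ℒ (U T) (V * U T * Vᴴ) := ⟨C, hC, by rw [hYinv, he], rfl⟩
  have hleast := isLeast_generatorNorms_unitaryDist ℒ ⟨_, hmemC⟩
  have hpos : 0 < ‖⁅H₀, V⁆‖ := norm_pos_iff.2 hV₀
  refine ⟨⟨⟨C₁, hC₁, he₁⟩, ⟨C₂, hC₂, he₂⟩, hleast⟩, ?_, ?_⟩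
  · rw [ge_iff_le, div_le_iff₀ hpos, ← hBnorm, mul_comm]
    exact (hleast.2 hmemC).trans hn
  · rw [ge_iff_le]
    gcongr
    obtain ⟨E, hE, heE, hnE⟩ := hleast.1
    rw [← hnE]
    refine le_trans (le_of_eq ?_) (norm_exp_sub_one_le_of_antiHermitian (hℒ E hE))
    have hYY : (V * U T * Vᴴ)ᴴ * (V * U T * Vᴴ) = 1 := by
      rw [hYstar, ← he₂, exp_neg_mul_exp_self]
    -- Right multiplication by unitaries turns `e^E - 1` into the commutator, so the two have equal
    -- norm.
    have hcomm : (NormedSpace.exp E - 1) * (V * U T * Vᴴ) * V = ⁅U T, V⁆ := by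
      rw [heE, hYinv, Matrix.sub_mul, Matrix.mul_assoc (U T), hYY, Matrix.mul_one, Matrix.one_mul,
        Matrix.sub_mul, Matrix.mul_assoc _ Vᴴ, hVV', Matrix.mul_one, Ring.lie_def]
    rw [← hcomm, frobenius_norm_mul_unitary hVV, frobenius_norm_mul_unitary]
    rw [hYstar, ← he₂, exp_mul_exp_neg_self]
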